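/- Let $m,n,T_o\in\mathbb{N}$, let $\mathbf{H}\in\mathbb{R}^{m\times n}$ be a deterministic matrix with $\mathrm{rank}(\mathbf{H})=n-1$, and assume $T_o>n$. Let $\sigma\ge 0$ and let $\mathbf{n}\in\mathbb{R}^m$ be a deterministic unit vector (for instance a unit vector in the null space of $\mathbf{H}^T$). On a probability space, let $\mathbf{X}$ be a random $n\times T_o$ matrix whose columns are i.i.d. $\mathcal{N}(0,I_n)$, and let $\mathbf{E}$ be a random $m\times T_o$ matrix whose entries are i.i.d. $\mathcal{N}(0,\sigma^2)$. Put $\bar{\mathbf{Z}}=\mathbf{H}\mathbf{X}$, assume that $\bar{\mathbf{Z}}$ and $\mathbf{E}$ are independent, and define the first-order estimation error $$\boldsymbol{\delta}=-(\bar{\mathbf{Z}}^T)^{+}\,\mathbf{E}^T\mathbf{n}\in\mathbb{R}^m,$$ where $A^{+}$ denotes the Moore--Penrose pseudoinverse of $A$. Then $\boldsymbol{\delta}$ is square-integrable, has zero mean, and has covariance matrix $$\mathrm{Cov}(\boldsymbol{\delta})=\frac{\sigma^2}{T_o-n}\,(\mathbf{H}\mathbf{H}^T)^{+}.$$ -/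

import Mathlib

open MeasureTheory ProbabilityTheory Matrix
open scoped NNReal

/-- `B` is a Moore-Penrose pseudoinverse of the real matrix `A`: the four Penrose equations. -/
structure IsMoorePenrose {p q : ℕ} (A : Matrix (Fin p) (Fin q) ℝ)
    (B : Matrix (Fin q) (Fin p) ℝ) : Prop where
  mul_mul_self : A * B * A = A
  self_mul_mul : B * A * B = B
  transpose_left : (A * B)ᵀ = A * B
  transpose_right : (B * A)ᵀ = B * A

theorem IsMoorePenrose.unique {p q : ℕ} {A : Matrix (Fin p) (Fin q) ℝ}
    {B C : Matrix (Fin q) (Fin p) ℝ} (hB : IsMoorePenrose A B) (hC : IsMoorePenrose A C) :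
    B = C := by
  have h1 : A * B = A * C := by
    calc A * B = (A * B)ᵀ := hB.transpose_left.symm
      _ = ((A * C) * (A * B))ᵀ := by rw [← Matrix.mul_assoc, hC.mul_mul_self]
      _ = (A * B) * (A * C) := by
        rw [Matrix.transpose_mul, hB.transpose_left, hC.transpose_left]
      _ = A * C := by rw [← Matrix.mul_assoc, hB.mul_mul_self]
  have h2 : B * A = C * A := by
    calc B * A = (B * A)ᵀ := hB.transpose_right.symm
      _ = ((B * A) * (C * A))ᵀ := by
        rw [Matrix.mul_assoc B A, ← Matrix.mul_assoc A C, hC.mul_mul_self]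
      _ = (C * A) * (B * A) := by
        rw [Matrix.transpose_mul, hB.transpose_right, hC.transpose_right]
      _ = C * A := by rw [Matrix.mul_assoc C A, ← Matrix.mul_assoc A B, hB.mul_mul_self]
  calc B = B * A * B := hB.self_mul_mul.symm
    _ = C * (A * C) := by rw [h2, Matrix.mul_assoc, h1]
    _ = C := by rw [← Matrix.mul_assoc, hC.self_mul_mul]

theorem exists_isMoorePenrose {p q : ℕ} (A : Matrix (Fin p) (Fin q) ℝ) :
    ∃ B, IsMoorePenrose A B := by
  have hS : (Aᵀ * A).IsHermitian := by
    simpa [Matrix.conjTranspose_eq_transpose_of_trivial] using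
      Matrix.isHermitian_conjTranspose_mul_self A
  obtain ⟨P, hPS, hPSP, hSPS, hP⟩ : ∃ P : Matrix (Fin q) (Fin q) ℝ,
      (P * (Aᵀ * A))ᵀ = P * (Aᵀ * A) ∧ P * (Aᵀ * A) * P = P ∧
      (Aᵀ * A) * (P * (Aᵀ * A)) = Aᵀ * A ∧ Pᵀ = P := by
    have key := hS.spectral_theorem
    generalize Aᵀ * A = S at hS key
    set φ := Unitary.conjStarAlgAut ℝ (Matrix (Fin q) (Fin q) ℝ) hS.eigenvectorUnitary
    set d := hS.eigenvalues
    have hT : ∀ M, (φ M)ᵀ = φ Mᵀ := fun M => by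
      have := (map_star φ M).symm
      simpa [Matrix.star_eq_conjTranspose, Matrix.conjTranspose_eq_transpose_of_trivial] using this
    have hS' : S = φ (diagonal d) := by
      rw [key]; rfl
    have hd : ∀ i, d i * ((d i)⁻¹ * d i) = d i := fun i => by
      rcases eq_or_ne (d i) 0 with h | h <;> simp [h]
    have hd' : ∀ i, (d i)⁻¹ * d i * (d i)⁻¹ = (d i)⁻¹ := fun i => by
      rcases eq_or_ne (d i) 0 with h | h <;> simp [h]
    refine ⟨φ (diagonal fun i => (d i)⁻¹), ?_, ?_, ?_, ?_⟩
    · rw [hS', ← map_mul, hT, diagonal_mul_diagonal, diagonal_transpose]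
    · rw [hS', ← map_mul, ← map_mul, diagonal_mul_diagonal, diagonal_mul_diagonal]
      simp only [hd']
    · rw [hS', ← map_mul, ← map_mul, diagonal_mul_diagonal, diagonal_mul_diagonal]
      simp only [hd]
    · rw [hT, diagonal_transpose]
  have hA : A * (P * (Aᵀ * A)) = A := by
    have h0 : (A * (P * (Aᵀ * A) - 1))ᴴ * (A * (P * (Aᵀ * A) - 1)) = 0 := by
      rw [Matrix.conjTranspose_mul, Matrix.mul_assoc, ← Matrix.mul_assoc Aᴴ,
        Matrix.conjTranspose_eq_transpose_of_trivial A, Matrix.mul_sub, hSPS]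
      simp
    have h1 := Matrix.conjTranspose_mul_self_eq_zero.1 h0
    rw [Matrix.mul_sub, Matrix.mul_one, sub_eq_zero] at h1
    exact h1
  refine ⟨P * Aᵀ, ?_, ?_, ?_, ?_⟩
  · rw [Matrix.mul_assoc, Matrix.mul_assoc, hA]
  · rw [Matrix.mul_assoc P, ← Matrix.mul_assoc (P * (Aᵀ * A)), hPSP]
  · simp only [Matrix.transpose_mul, Matrix.transpose_transpose, hP, Matrix.mul_assoc]
  · rw [Matrix.mul_assoc]; exact hPS

/-- The Moore-Penrose pseudoinverse `A⁺` of a real matrix. -/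
noncomputable def pinv {p q : ℕ} (A : Matrix (Fin p) (Fin q) ℝ) : Matrix (Fin q) (Fin p) ℝ :=
  Classical.choose (exists_isMoorePenrose A)

theorem pinv_spec {p q : ℕ} (A : Matrix (Fin p) (Fin q) ℝ) : IsMoorePenrose A (pinv A) :=
  Classical.choose_spec (exists_isMoorePenrose A)

/-- The first-order estimation error `δ = -(Z̄ᵀ)⁺ Eᵀ n`. -/
noncomputable def firstOrderError {m T : ℕ} (Zbar E : Matrix (Fin m) (Fin T) ℝ)
    (nv : Fin m → ℝ) : Fin m → ℝ :=
  -((pinv Zbarᵀ * Eᵀ) *ᵥ nv)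

/-- Mean vector of a random vector. -/
noncomputable def meanVec {Ω : Type*} [MeasurableSpace Ω] {m : ℕ} (Y : Ω → Fin m → ℝ)
    (P : Measure Ω) : Fin m → ℝ :=
  fun i => ∫ ω, Y ω i ∂P

/-- Covariance matrix of a random vector. -/
noncomputable def covMatrix {Ω : Type*} [MeasurableSpace Ω] {m : ℕ} (Y : Ω → Fin m → ℝ)
    (P : Measure Ω) : Matrix (Fin m) (Fin m) ℝ :=
  Matrix.of fun i j => covariance (fun ω => Y ω i) (fun ω => Y ω j) P

/-- The columns of the random matrix `X` are i.i.d. with law `N(0, I_n)`. -/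
structure ColumnsIIDStdGaussian {Ω : Type*} [MeasurableSpace Ω] {n T : ℕ}
    (X : Ω → Matrix (Fin n) (Fin T) ℝ) (P : Measure Ω) : Prop where
  law : ∀ t : Fin T, HasLaw (fun ω => (WithLp.toLp 2 fun i => X ω i t : EuclideanSpace ℝ (Fin n)))
    (multivariateGaussian 0 1) P
  indep : iIndepFun
    (fun (t : Fin T) ω => (WithLp.toLp 2 fun i => X ω i t : EuclideanSpace ℝ (Fin n))) P

/-- The entries of the random matrix `E` are i.i.d. with law `N(0, σ²)`. -/
structure EntriesIIDGaussian {Ω : Type*} [MeasurableSpace Ω] {m T : ℕ}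
    (E : Ω → Matrix (Fin m) (Fin T) ℝ) (σ : ℝ≥0) (P : Measure Ω) : Prop where
  law : ∀ (i : Fin m) (t : Fin T), HasLaw (fun ω => E ω i t) (gaussianReal 0 (σ ^ 2)) P
  indep : iIndepFun (fun (p : Fin m × Fin T) ω => E ω p.1 p.2) P

/-! With `r = n - 1` the rank of `H`, factor `H = F * C`, where `C` has orthonormal rows and the
left inverse `L` of `F` makes `F * L` an orthogonal projection. The rows of `W = C * X` are i.i.d.
standard Gaussian in dimension `T`, and almost surely the pseudoinverse of `(F * W)ᵀ` is `Lᵀ * (W *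
Wᵀ)⁻¹ * W`, while that of `H * Hᵀ` is `Lᵀ * L`. The noise `Eᵀ n` is centred, has covariance `σ² I`,
and is independent of `W`, so the covariance of the error is `σ² Lᵀ 𝔼[(W Wᵀ)⁻¹] L`.

What remains is the inverse Wishart mean, `𝔼[(W Wᵀ)⁻¹] = I / (T - r - 1)`. A diagonal entry is the
inverse squared distance from one row to the span of the others (`inv_gram_apply_self`). Given
those, this distance is the norm of a standard Gaussian vector in dimension `k = T - r + 1`, and `1
/ ‖x‖²` has mean `1 / (k - 2)` (`lintegral_inv_norm_sq_stdGaussian`). Off-diagonal entries average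
to zero under the sign flip of one row. -/

/-! ### Inverse squared norms of Gaussian vectors and of their projections -/

theorem lintegral_Ioi_exp_neg_mul {a : ℝ} (ha : 0 ≤ a) :
    ∫⁻ s in Set.Ioi (0 : ℝ), ENNReal.ofReal (Real.exp (-(s * a))) = (ENNReal.ofReal a)⁻¹ := by
  rcases ha.eq_or_lt with rfl | ha
  -- Both sides are infinite, so the vector `x = 0` needs no separate treatment later.
  · simp
  · have h1 : IntegrableOn (fun s : ℝ => Real.exp (-a * s)) (Set.Ioi 0) :=
      integrableOn_exp_mul_Ioi (by linarith) 0
    have h2 := integral_exp_mul_Ioi (a := -a) (by linarith) 0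
    have h3 : (fun s : ℝ => Real.exp (-(s * a))) = fun s => Real.exp (-a * s) := by
      ext s; ring_nf
    rw [← ofReal_integral_eq_lintegral_ofReal (by rw [h3]; exact h1)
      (ae_of_all _ fun _ => (Real.exp_pos _).le), h3, h2, ← ENNReal.ofReal_inv_of_pos ha]
    congr 1
    simp

theorem integral_exp_neg_mul_sq_gaussianReal {s : ℝ} (hs : 0 ≤ s) :
    ∫ x, Real.exp (-(s * x ^ 2)) ∂(gaussianReal 0 1) = (1 + 2 * s) ^ (-(1 / 2) : ℝ) := by
  rw [integral_gaussianReal_eq_integral_smul one_ne_zero]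
  have h : ∀ x : ℝ, gaussianPDFReal 0 1 x • Real.exp (-(s * x ^ 2))
      = (√(2 * Real.pi))⁻¹ * Real.exp (-(1 / 2 + s) * x ^ 2) := by
    intro x
    simp only [gaussianPDFReal, smul_eq_mul, NNReal.coe_one, mul_one, sub_zero, mul_assoc,
      ← Real.exp_add]
    congr 2
    ring
  simp_rw [h]
  rw [integral_const_mul, integral_gaussian, Real.rpow_neg (by positivity), ← Real.sqrt_eq_rpow,
    ← Real.sqrt_inv, ← Real.sqrt_mul (by positivity), ← Real.sqrt_inv]
  congr 1
  have := Real.pi_pos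
  field_simp

theorem integral_exp_neg_mul_norm_sq_stdGaussian {E : Type*} [NormedAddCommGroup E]
    [InnerProductSpace ℝ E] [FiniteDimensional ℝ E] [MeasurableSpace E] [BorelSpace E]
    {s : ℝ} (hs : 0 ≤ s) :
    ∫ x, Real.exp (-(s * ‖x‖ ^ 2)) ∂(stdGaussian E)
      = (1 + 2 * s) ^ (-(Module.finrank ℝ E / 2) : ℝ) := by
  rw [stdGaussian, integral_map (Measurable.aemeasurable (by fun_prop))
    (Measurable.aestronglyMeasurable (by fun_prop))]
  have h : ∀ x : Fin (Module.finrank ℝ E) → ℝ,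
      Real.exp (-(s * ‖∑ i, x i • stdOrthonormalBasis ℝ E i‖ ^ 2))
        = ∏ i, Real.exp (-(s * x i ^ 2)) := by
    intro x
    have hn : ‖∑ i, x i • stdOrthonormalBasis ℝ E i‖ ^ 2 = ∑ i, x i ^ 2 := by
      rw [← real_inner_self_eq_norm_sq,
        (stdOrthonormalBasis ℝ E).orthonormal.inner_sum x x Finset.univ]
      simp [sq]
    rw [hn, Finset.mul_sum, ← Finset.sum_neg_distrib, Real.exp_sum]
  simp_rw [h]
  rw [integral_fintype_prod_eq_prod (f := fun _ x => Real.exp (-(s * x ^ 2)))]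
  simp only [integral_exp_neg_mul_sq_gaussianReal hs, Finset.prod_const, Finset.card_univ,
    Fintype.card_fin]
  rw [← Real.rpow_natCast, ← Real.rpow_mul (by positivity)]
  congr 1
  ring

theorem lintegral_Ioi_one_add_rpow {k : ℝ} (hk : 2 < k) :
    ∫⁻ s in Set.Ioi (0 : ℝ), ENNReal.ofReal ((1 + 2 * s) ^ (-(k / 2)))
      = ENNReal.ofReal (k - 2)⁻¹ := by
  -- An explicit antiderivative; it vanishes at infinity because `k > 2`.
  have hd : ∀ x ∈ Set.Ici (0 : ℝ), HasDerivAt (fun s : ℝ => -(k - 2)⁻¹ * (1 + 2 * s) ^ (1 - k / 2))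
      ((1 + 2 * x) ^ (-(k / 2))) x := by
    intro x hx
    have hx : 0 ≤ x := hx
    have h1 : HasDerivAt (fun s : ℝ => 1 + 2 * s) 2 x := by
      simpa using ((hasDerivAt_id x).const_mul 2).const_add 1
    have h2 := (h1.rpow_const (p := 1 - k / 2) (Or.inl (by positivity))).const_mul (-(k - 2)⁻¹)
    refine h2.congr_deriv ?_
    rw [show (1 - k / 2 - 1) = -(k / 2) by ring]
    have : k - 2 ≠ 0 := by linarith
    field_simp
    ring
  have hnn : ∀ x ∈ Set.Ioi (0 : ℝ), 0 ≤ (1 + 2 * x) ^ (-(k / 2)) := by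
    intro x hx
    have hx : 0 < x := hx
    positivity
  have ht : Filter.Tendsto (fun s : ℝ => -(k - 2)⁻¹ * (1 + 2 * s) ^ (1 - k / 2)) Filter.atTop
      (nhds 0) := by
    have h1 : Filter.Tendsto (fun s : ℝ => 1 + 2 * s) Filter.atTop Filter.atTop :=
      Filter.tendsto_atTop_add_const_left _ _ (Filter.tendsto_id.const_mul_atTop (by norm_num))
    have h2 := (tendsto_rpow_neg_atTop (y := k / 2 - 1) (by linarith)).comp h1
    have h3 := h2.const_mul (-(k - 2)⁻¹)
    simpa [Function.comp_def] using h3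
  rw [← ofReal_integral_eq_lintegral_ofReal (integrableOn_Ioi_deriv_of_nonneg' hd hnn ht)
    ((ae_restrict_iff' measurableSet_Ioi).2 (ae_of_all _ hnn)),
    integral_Ioi_of_hasDerivAt_of_nonneg' hd hnn ht]
  simp

/-- The mean of `1 / ‖x‖ ^ 2` under the standard Gaussian measure. -/
theorem lintegral_inv_norm_sq_stdGaussian (E : Type*) [NormedAddCommGroup E]
    [InnerProductSpace ℝ E] [FiniteDimensional ℝ E] [MeasurableSpace E] [BorelSpace E]
    (hE : 2 < Module.finrank ℝ E) :
    ∫⁻ x, (ENNReal.ofReal (‖x‖ ^ 2))⁻¹ ∂(stdGaussian E)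
      = ENNReal.ofReal ((Module.finrank ℝ E : ℝ) - 2)⁻¹ := by
  have hE' : (2 : ℝ) < Module.finrank ℝ E := by exact_mod_cast hE
  -- Write `1 / ‖x‖²` as the integral of `exp (-s ‖x‖²)` over `s > 0` and apply Tonelli: the
  -- Gaussian integral then factors over coordinates.
  simp_rw [← lintegral_Ioi_exp_neg_mul (sq_nonneg ‖_‖)]
  rw [lintegral_lintegral_swap (Measurable.aemeasurable (by fun_prop)),
    ← lintegral_Ioi_one_add_rpow hE']
  refine setLIntegral_congr_fun measurableSet_Ioi fun s hs => ?_
  have hs : 0 < s := hs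
  rw [← integral_exp_neg_mul_norm_sq_stdGaussian hs.le, ofReal_integral_eq_lintegral_ofReal]
  · refine Integrable.of_bound (C := 1) (Measurable.aestronglyMeasurable (by fun_prop))
      (ae_of_all _ fun x => ?_)
    rw [Real.norm_of_nonneg (Real.exp_pos _).le]
    exact Real.exp_le_one_iff.2 (neg_nonpos.2 (by positivity))
  · exact ae_of_all _ fun _ => (Real.exp_pos _).le

/-- A linear map whose adjoint is isometric sends the standard Gaussian measure to the standard
Gaussian measure. -/
theorem stdGaussian_map_of_norm_adjoint {E F : Type*} [NormedAddCommGroup E]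
    [InnerProductSpace ℝ E] [FiniteDimensional ℝ E] [MeasurableSpace E] [BorelSpace E]
    [NormedAddCommGroup F] [InnerProductSpace ℝ F] [FiniteDimensional ℝ F] [MeasurableSpace F]
    [BorelSpace F] (f : E →L[ℝ] F) (hf : ∀ y, ‖ContinuousLinearMap.adjoint f y‖ = ‖y‖) :
    (stdGaussian E).map f = stdGaussian F := by
  apply Measure.ext_of_charFun
  ext t
  have h : charFun ((stdGaussian E).map f) t
      = charFun (stdGaussian E) (ContinuousLinearMap.adjoint f t) := by
    rw [charFun_apply, charFun_apply, integral_map (by fun_prop) (by fun_prop)]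
    simp only [ContinuousLinearMap.adjoint_inner_right]
  rw [h, charFun_stdGaussian, charFun_stdGaussian, hf]

theorem stdGaussian_map_orthogonalProjection {E : Type*} [NormedAddCommGroup E]
    [InnerProductSpace ℝ E] [FiniteDimensional ℝ E] [MeasurableSpace E] [BorelSpace E]
    (S : Submodule ℝ E) :
    (stdGaussian E).map S.orthogonalProjectionOnto = stdGaussian S := by
  refine stdGaussian_map_of_norm_adjoint _ fun y => ?_
  rw [Submodule.adjoint_orthogonalProjectionOnto]
  simp

/-- The mean of `1 / ‖P x‖ ^ 2` under the standard Gaussian measure, for the orthogonal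
projection `P` onto a subspace. -/
theorem lintegral_inv_norm_sq_orthogonalProjection {E : Type*} [NormedAddCommGroup E]
    [InnerProductSpace ℝ E] [FiniteDimensional ℝ E] [MeasurableSpace E] [BorelSpace E]
    (S : Submodule ℝ E) (hS : 2 < Module.finrank ℝ S) :
    ∫⁻ x, (ENNReal.ofReal (‖S.orthogonalProjectionOnto x‖ ^ 2))⁻¹ ∂(stdGaussian E)
      = ENNReal.ofReal ((Module.finrank ℝ S : ℝ) - 2)⁻¹ := by
  rw [← lintegral_inv_norm_sq_stdGaussian S hS, ← stdGaussian_map_orthogonalProjection S,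
    lintegral_map (by fun_prop) (by fun_prop)]

/-- On `S` the projection to `Sᗮ` vanishes, so its inverse squared norm is infinite there; a finite
mean makes this a null event. -/
theorem ae_stdGaussian_notMem {E : Type*} [NormedAddCommGroup E]
    [InnerProductSpace ℝ E] [FiniteDimensional ℝ E] [MeasurableSpace E] [BorelSpace E]
    (S : Submodule ℝ E) (hS : 2 < Module.finrank ℝ Sᗮ) :
    ∀ᵐ x ∂(stdGaussian E), x ∉ S := by
  have h := lintegral_inv_norm_sq_orthogonalProjection Sᗮ hS
  have h1 := ae_lt_top' (Measurable.aemeasurable (by fun_prop))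
    (h.trans_lt ENNReal.ofReal_lt_top).ne
  filter_upwards [h1] with x hx hxS
  rw [Submodule.orthogonalProjectionOnto_apply_of_mem_orthogonal] at hx
  · simp at hx
  · simpa using hxS

/-! ### Measurability of determinants and inverses -/

theorem measurable_matrix_det {α ι : Type*} [MeasurableSpace α] [Fintype ι] [DecidableEq ι]
    {A : α → Matrix ι ι ℝ} (hA : ∀ i j, Measurable fun a => A a i j) :
    Measurable fun a => (A a).det := by
  simp only [Matrix.det_apply]
  refine Finset.measurable_sum _ fun σ _ => Measurable.const_smul ?_ _
  exact Finset.measurable_prod _ fun i _ => hA _ _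

theorem measurable_matrix_inv_apply {α ι : Type*} [MeasurableSpace α] [Fintype ι] [DecidableEq ι]
    {A : α → Matrix ι ι ℝ} (hA : ∀ i j, Measurable fun a => A a i j) (i j : ι) :
    Measurable fun a => (A a)⁻¹ i j := by
  simp only [Matrix.inv_def, Ring.inverse_eq_inv', Matrix.smul_apply, smul_eq_mul,
    Matrix.adjugate_apply]
  refine (measurable_matrix_det hA).inv.mul (measurable_matrix_det fun k l => ?_)
  simp only [Matrix.updateRow_apply]
  split_ifs
  · exact measurable_const
  · exact hA k l

/-! ### Inverse Gram matrices of Gaussian vectors -/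

section Gram

variable {E : Type*} [NormedAddCommGroup E] [InnerProductSpace ℝ E] [FiniteDimensional ℝ E]

/-- Row `i` of the inverse Gram matrix holds the coordinates of the vector `b` dual to `w i`. Being
orthogonal to the other vectors, `b` is a multiple of the component of `w i` orthogonal to them, and
pairing with `w i` fixes the multiple. -/
theorem inv_gram_apply_self {r : ℕ} {w : Fin (r + 1) → E} (hw : LinearIndependent ℝ w)
    (i : Fin (r + 1)) {v : Fin r → E} (hv : ∀ j, w (i.succAbove j) = v j) :
    (gram ℝ w)⁻¹ i i =
      (‖(Submodule.span ℝ (Set.range v))ᗮ.orthogonalProjectionOnto (w i)‖ ^ 2)⁻¹ := by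
  obtain rfl : (fun j => w (i.succAbove j)) = v := funext hv
  set S := Submodule.span ℝ (Set.range fun j => w (i.succAbove j)) with hS
  have hdet : IsUnit (gram ℝ w).det :=
    isUnit_iff_ne_zero.2 (det_gram_ne_zero_iff_linearIndependent.2 hw)
  set b : E := ∑ j, (gram ℝ w)⁻¹ i j • w j with hb
  have hbw : ∀ k, inner ℝ b (w k) = (1 : Matrix _ _ ℝ) i k := by
    intro k
    rw [← Matrix.nonsing_inv_mul _ hdet, Matrix.mul_apply, hb, sum_inner]
    simp [real_inner_smul_left, gram_apply]
  have hbS : b ∈ Sᗮ := by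
    rw [hS, Submodule.mem_orthogonal']
    intro u hu
    induction hu using Submodule.span_induction with
    | mem x hx =>
      obtain ⟨j, rfl⟩ := hx
      rw [hbw, Matrix.one_apply_ne (Fin.succAbove_ne i j).symm]
    | zero => simp
    | add x y _ _ hx hy => rw [inner_add_right, hx, hy, add_zero]
    | smul a x _ hx => rw [real_inner_smul_right, hx, mul_zero]
  have hproj : ∀ j, Sᗮ.orthogonalProjectionOnto (w (i.succAbove j)) = 0 := fun j => by
    apply Submodule.orthogonalProjectionOnto_apply_of_mem_orthogonal
    rw [Submodule.orthogonal_orthogonal]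
    exact Submodule.subset_span ⟨j, rfl⟩
  have hb' : b = (gram ℝ w)⁻¹ i i • (Sᗮ.orthogonalProjectionOnto (w i) : E) := by
    have h1 : (Sᗮ.orthogonalProjectionOnto b : E) = b :=
      Submodule.starProjection_eq_self_iff.2 hbS
    rw [← h1, hb, map_sum, i.sum_univ_succAbove]
    simp [hproj]
  have h1 : (gram ℝ w)⁻¹ i i * ‖Sᗮ.orthogonalProjectionOnto (w i)‖ ^ 2 = 1 := by
    have h2 := hbw i
    rw [hb', real_inner_smul_left, Matrix.one_apply_eq] at h2
    rw [← h2, ← real_inner_self_eq_norm_sq]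
    congr 1
    exact (Submodule.inner_orthogonalProjectionOnto_eq_of_mem_left _ _)
  exact eq_inv_of_mul_eq_one_left h1

variable [MeasurableSpace E] [BorelSpace E]

theorem measurable_inv_gram_apply {r : ℕ} (i j : Fin r) :
    Measurable fun w : Fin r → E => (gram ℝ w)⁻¹ i j :=
  measurable_matrix_inv_apply (fun k l => by simp only [gram_apply]; fun_prop) i j

/-- Each new vector almost surely avoids the span of the previous ones. The bound on `r` leaves that
span a complement of dimension above 2, as `ae_stdGaussian_notMem` requires. -/
theorem ae_linearIndependent_stdGaussian {r : ℕ} (hr : r + 1 < Module.finrank ℝ E) :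
    ∀ᵐ w ∂(Measure.pi fun _ : Fin r => stdGaussian E), LinearIndependent ℝ w := by
  induction r with
  | zero => exact ae_of_all _ fun w => linearIndependent_empty_type
  | succ r ih =>
    have hmp := measurePreserving_piFinSuccAbove (fun _ : Fin (r + 1) => stdGaussian E) 0
    have hmeas : MeasurableSet {p : E × (Fin r → E) |
        LinearIndependent ℝ (Fin.cons p.1 p.2 : Fin (r + 1) → E)} := by
      have : Continuous fun p : E × (Fin r → E) => (Fin.cons p.1 p.2 : Fin (r + 1) → E) := by
        fun_prop
      exact (isOpen_setOfPred_linearIndependent.preimage this).measurableSet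
    have hprod : ∀ᵐ p ∂((stdGaussian E).prod (Measure.pi fun _ : Fin r => stdGaussian E)),
        LinearIndependent ℝ (Fin.cons p.1 p.2 : Fin (r + 1) → E) := by
      -- Swap the order so that the new vector varies while the old ones stay fixed.
      rw [Measure.ae_prod_iff_ae_ae hmeas, Measure.ae_ae_comm hmeas]
      filter_upwards [ih (by omega)] with v hv
      have hdim : 2 < Module.finrank ℝ (Submodule.span ℝ (Set.range v))ᗮ := by
        have h1 := Submodule.finrank_add_finrank_orthogonal (Submodule.span ℝ (Set.range v))
        rw [finrank_span_eq_card hv, Fintype.card_fin] at h1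
        omega
      filter_upwards [ae_stdGaussian_notMem _ hdim] with x hx
      exact linearIndependent_finCons.2 ⟨hv, hx⟩
    filter_upwards [hmp.quasiMeasurePreserving.ae hprod] with w hw
    convert hw using 1
    exact (Fin.cons_self_tail w).symm

theorem lintegral_inv_gram_apply_self {r : ℕ} (hr : r + 1 < Module.finrank ℝ E) (i : Fin r) :
    ∫⁻ w, ENNReal.ofReal ((gram ℝ w)⁻¹ i i) ∂(Measure.pi fun _ : Fin r => stdGaussian E)
      = ENNReal.ofReal ((Module.finrank ℝ E : ℝ) - r - 1)⁻¹ := by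
  obtain _ | r := r
  · exact i.elim0
  obtain ⟨e, hei, hej, hmp⟩ : ∃ e : E × (Fin r → E) → (Fin (r + 1) → E),
      (∀ x v, e (x, v) i = x) ∧ (∀ x v j, e (x, v) (i.succAbove j) = v j) ∧
      MeasurePreserving e ((stdGaussian E).prod (Measure.pi fun _ : Fin r => stdGaussian E))
        (Measure.pi fun _ : Fin (r + 1) => stdGaussian E) :=
    ⟨(MeasurableEquiv.piFinSuccAbove (fun _ => E) i).symm,
      fun x v => Fin.insertNth_apply_same (α := fun _ => E) i x v,
      fun x v j => Fin.insertNth_apply_succAbove (α := fun _ => E) i x v j,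
      (measurePreserving_piFinSuccAbove (fun _ : Fin (r + 1) => stdGaussian E) i).symm⟩
  have hmeas := (measurable_inv_gram_apply (E := E) i i).ennreal_ofReal
  rw [← hmp.lintegral_comp hmeas,
    lintegral_prod_symm' (fun p => ENNReal.ofReal ((gram ℝ (e p))⁻¹ i i))
      (hmeas.comp hmp.measurable)]
  have hae := hmp.quasiMeasurePreserving.ae (ae_linearIndependent_stdGaussian hr)
  have hswap := Measure.ae_ae_of_ae_prod
    (Measure.measurePreserving_swap.quasiMeasurePreserving.ae hae)
  -- Here `r` counts only the other vectors, so the complement has dimension `d - r`, with `d` that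
  -- of `E`, and the mean is `1 / (d - r - 2) = 1 / (d - (r + 1) - 1)`.
  have hconst : ∀ᵐ v ∂(Measure.pi fun _ : Fin r => stdGaussian E),
      ∫⁻ x, ENNReal.ofReal ((gram ℝ (e (x, v)))⁻¹ i i) ∂(stdGaussian E)
      = ENNReal.ofReal ((Module.finrank ℝ E : ℝ) - (r + 1 : ℕ) - 1)⁻¹ := by
    filter_upwards [hswap, ae_linearIndependent_stdGaussian (E := E) (r := r) (by omega)]
      with v hv hvli
    have hdim : Module.finrank ℝ (Submodule.span ℝ (Set.range v))ᗮ + r = Module.finrank ℝ E := by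
      have h1 := Submodule.finrank_add_finrank_orthogonal (Submodule.span ℝ (Set.range v))
      rw [finrank_span_eq_card hvli, Fintype.card_fin] at h1
      omega
    have h2 := lintegral_inv_norm_sq_orthogonalProjection (Submodule.span ℝ (Set.range v))ᗮ
      (by omega)
    rw [← hdim]
    convert h2 using 1
    · refine lintegral_congr_ae ?_
      filter_upwards [hv, ae_stdGaussian_notMem (Submodule.span ℝ (Set.range v)) (by omega)]
        with x hx hxv
      have h3 := inv_gram_apply_self hx i (hej x v)
      simp only [Prod.swap_prod_mk, hei] at h3
      rw [h3, ENNReal.ofReal_inv_of_pos]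
      have hne : (Submodule.span ℝ (Set.range v))ᗮ.orthogonalProjectionOnto x ≠ 0 := by
        intro h0
        rw [Submodule.orthogonalProjectionOnto_eq_zero_iff, Submodule.orthogonal_orthogonal] at h0
        exact hxv h0
      exact pow_pos (norm_pos_iff.2 hne) 2
    · congr 2
      push_cast
      ring
  rw [lintegral_congr_ae hconst]
  simp

theorem integrable_inv_gram_apply_self {r : ℕ} (hr : r + 1 < Module.finrank ℝ E) (i : Fin r) :
    Integrable (fun w => (gram ℝ w)⁻¹ i i) (Measure.pi fun _ : Fin r => stdGaussian E) := by
  refine ⟨(measurable_inv_gram_apply i i).aestronglyMeasurable, ?_⟩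
  rw [hasFiniteIntegral_iff_ofReal, lintegral_inv_gram_apply_self hr]
  · exact ENNReal.ofReal_lt_top
  · exact ae_of_all _ fun w => (posSemidef_gram ℝ w).inv.diag_nonneg

theorem integral_inv_gram_apply_self {r : ℕ} (hr : r + 1 < Module.finrank ℝ E) (i : Fin r) :
    ∫ w, (gram ℝ w)⁻¹ i i ∂(Measure.pi fun _ : Fin r => stdGaussian E)
      = ((Module.finrank ℝ E : ℝ) - r - 1)⁻¹ := by
  have hr' : (r : ℝ) + 1 < Module.finrank ℝ E := by exact_mod_cast hr
  rw [integral_eq_lintegral_of_nonneg_ae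
    (ae_of_all _ fun w => (posSemidef_gram ℝ w).inv.diag_nonneg)
    (measurable_inv_gram_apply i i).aestronglyMeasurable, lintegral_inv_gram_apply_self hr,
    ENNReal.toReal_ofReal (inv_nonneg.2 (by linarith))]

/-- Negating `w i` preserves the joint law and flips the sign of this entry, so its mean equals its
own negative. -/
theorem integral_inv_gram_apply_of_ne {r : ℕ} {i j : Fin r} (hij : i ≠ j) :
    ∫ w, (gram ℝ w)⁻¹ i j ∂(Measure.pi fun _ : Fin r => stdGaussian E) = 0 := by
  have hneg : (stdGaussian E).map (fun x => -x) = stdGaussian E :=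
    stdGaussian_map (LinearIsometryEquiv.neg ℝ)
  set d : Fin r → ℝ := fun k => if k = i then -1 else 1 with hd
  have hdd : diagonal d * diagonal d = 1 := by
    rw [diagonal_mul_diagonal, ← diagonal_one]
    congr 1
    ext k
    by_cases hk : k = i <;> simp [hd, hk]
  have hmp : MeasurePreserving (fun (w : Fin r → E) k => d k • w k)
      (Measure.pi fun _ : Fin r => stdGaussian E) (Measure.pi fun _ : Fin r => stdGaussian E) := by
    refine measurePreserving_pi _ _ fun k => ⟨by fun_prop, ?_⟩
    by_cases hk : k = i
    · rw [show (HSMul.hSMul (d k) : E → E) = fun x => -x by ext x; simp [hd, hk], hneg]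
    · rw [show (HSMul.hSMul (d k) : E → E) = fun x => x by ext x; simp [hd, hk], Measure.map_id']
  have hgram : ∀ w : Fin r → E, (gram ℝ fun k => d k • w k)⁻¹ i j = -(gram ℝ w)⁻¹ i j := by
    intro w
    have h1 : (gram ℝ fun k => d k • w k) = diagonal d * gram ℝ w * diagonal d := by
      ext k l
      simp [gram_apply, real_inner_smul_left, real_inner_smul_right, mul_comm, mul_left_comm]
    rw [h1, Matrix.mul_inv_rev, Matrix.mul_inv_rev, Matrix.inv_eq_right_inv hdd,
      ← Matrix.mul_assoc, Matrix.mul_diagonal, Matrix.diagonal_mul]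
    simp [hd, hij.symm]
  have h := integral_map (f := fun w : Fin r → E => (gram ℝ w)⁻¹ i j) hmp.aemeasurable
    (measurable_inv_gram_apply i j).aestronglyMeasurable
  rw [hmp.map_eq] at h
  simp_rw [hgram, integral_neg] at h
  linarith

end Gram

/-! ### Pseudoinverses through a rank factorization -/

/-- The two products are the orthogonal projections onto the row space of `W` and onto the column
space of `F`, the latter being `F * L`. -/
theorem isMoorePenrose_transpose_mul {m r T : ℕ} {F : Matrix (Fin m) (Fin r) ℝ}
    {L : Matrix (Fin r) (Fin m) ℝ} (hLF : L * F = 1) (hFL : (F * L)ᵀ = F * L)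
    {W : Matrix (Fin r) (Fin T) ℝ} (hW : IsUnit (W * Wᵀ).det) :
    IsMoorePenrose (F * W)ᵀ (Lᵀ * ((W * Wᵀ)⁻¹ * W)) := by
  have hFL' : Fᵀ * Lᵀ = 1 := by rw [← Matrix.transpose_mul, hLF, Matrix.transpose_one]
  have hAB : (F * W)ᵀ * (Lᵀ * ((W * Wᵀ)⁻¹ * W)) = Wᵀ * ((W * Wᵀ)⁻¹ * W) := by
    rw [Matrix.transpose_mul, Matrix.mul_assoc, ← Matrix.mul_assoc Fᵀ, hFL', Matrix.one_mul]
  have hBA : (Lᵀ * ((W * Wᵀ)⁻¹ * W)) * (F * W)ᵀ = F * L := by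
    rw [Matrix.transpose_mul, Matrix.mul_assoc, ← Matrix.mul_assoc _ Wᵀ, Matrix.mul_assoc _ W,
      Matrix.nonsing_inv_mul _ hW, Matrix.one_mul, ← Matrix.transpose_mul, hFL]
  refine ⟨?_, ?_, ?_, ?_⟩
  · rw [Matrix.mul_assoc, hBA, ← hFL, ← Matrix.transpose_mul, Matrix.mul_assoc,
      ← Matrix.mul_assoc L, hLF, Matrix.one_mul]
  · rw [hBA, ← hFL, Matrix.transpose_mul, Matrix.mul_assoc, ← Matrix.mul_assoc Fᵀ, hFL',
      Matrix.one_mul]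
  · rw [hAB]
    simp only [Matrix.transpose_mul, Matrix.transpose_transpose, Matrix.transpose_nonsing_inv,
      Matrix.mul_assoc]
  · rw [hBA, hFL]

/-- Orthonormality of the rows of `C` removes `C`, leaving `F * Fᵀ`; its product with `Lᵀ * L` in
either order is the projection `F * L`. -/
theorem isMoorePenrose_mul_transpose {m n r : ℕ} {F : Matrix (Fin m) (Fin r) ℝ}
    {L : Matrix (Fin r) (Fin m) ℝ} (hLF : L * F = 1) (hFL : (F * L)ᵀ = F * L)
    {C : Matrix (Fin r) (Fin n) ℝ} (hC : C * Cᵀ = 1) :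
    IsMoorePenrose ((F * C) * (F * C)ᵀ) (Lᵀ * L) := by
  have hFL' : Fᵀ * Lᵀ = 1 := by rw [← Matrix.transpose_mul, hLF, Matrix.transpose_one]
  have hA : (F * C) * (F * C)ᵀ = F * Fᵀ := by
    rw [Matrix.transpose_mul, Matrix.mul_assoc, ← Matrix.mul_assoc C, hC, Matrix.one_mul]
  have hAB : F * Fᵀ * (Lᵀ * L) = F * L := by
    rw [Matrix.mul_assoc, ← Matrix.mul_assoc Fᵀ, hFL', Matrix.one_mul]
  have hBA : Lᵀ * L * (F * Fᵀ) = F * L := by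
    rw [Matrix.mul_assoc, ← Matrix.mul_assoc L, hLF, Matrix.one_mul, ← Matrix.transpose_mul, hFL]
  rw [hA]
  refine ⟨?_, ?_, ?_, ?_⟩
  · rw [hAB, Matrix.mul_assoc, ← Matrix.mul_assoc L, hLF, Matrix.one_mul]
  · rw [hBA, ← hFL, Matrix.transpose_mul, Matrix.mul_assoc, ← Matrix.mul_assoc Fᵀ, hFL',
      Matrix.one_mul]
  · rw [hAB, hFL]
  · rw [hBA, hFL]

/-- A rank factorization `H = F * C` in which `C` has orthonormal rows, together with the left
inverse `L` of `F` for which `F * L` is an orthogonal projection. -/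
theorem exists_rank_factorization {m n : ℕ} (H : Matrix (Fin m) (Fin n) ℝ) :
    ∃ (F : Matrix (Fin m) (Fin H.rank) ℝ) (C : Matrix (Fin H.rank) (Fin n) ℝ)
      (L : Matrix (Fin H.rank) (Fin m) ℝ),
      H = F * C ∧ C * Cᵀ = 1 ∧ L * F = 1 ∧ (F * L)ᵀ = F * L := by
  set V : Submodule ℝ (EuclideanSpace ℝ (Fin n)) :=
    Submodule.span ℝ (Set.range fun i => WithLp.toLp 2 (H i)) with hV
  have hdim : Module.finrank ℝ V = H.rank := by
    rw [Matrix.rank_eq_finrank_span_row,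
      ← LinearEquiv.finrank_map_eq (WithLp.linearEquiv 2 ℝ (Fin n → ℝ)) V, hV,
      Submodule.map_span, ← Set.range_comp]
    rfl
  let b : OrthonormalBasis (Fin H.rank) ℝ V :=
    (stdOrthonormalBasis ℝ V).reindex (finCongr hdim)
  let C : Matrix (Fin H.rank) (Fin n) ℝ := Matrix.of fun k j => (b k : EuclideanSpace ℝ (Fin n)) j
  have hC : C * Cᵀ = 1 := by
    ext k l
    have h := (orthonormal_iff_ite.1 b.orthonormal) l k
    rw [Submodule.coe_inner, PiLp.inner_apply] at h
    simp only [Matrix.mul_apply, Matrix.transpose_apply, C, Matrix.of_apply, Matrix.one_apply]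
    simpa [eq_comm] using h
  -- `Cᵀ * C` is the orthogonal projection onto the row space of `H`, which fixes every row.
  have hH : H = H * Cᵀ * C := by
    ext i j
    have hi : WithLp.toLp 2 (H i) ∈ V := Submodule.subset_span ⟨i, rfl⟩
    have h := b.sum_repr' ⟨_, hi⟩
    have h' := congrArg (fun x : V => (x : EuclideanSpace ℝ (Fin n)) j) h
    simp only [Submodule.coe_sum, Submodule.coe_smul, Submodule.coe_inner, PiLp.inner_apply,
      WithLp.ofLp_sum, Finset.sum_apply, PiLp.smul_apply, smul_eq_mul] at h'
    rw [Matrix.mul_apply, ← h']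
    refine Finset.sum_congr rfl fun k _ => ?_
    simp [Matrix.mul_apply, C]
  set F := H * Cᵀ with hF
  have hrank : (Fᵀ * F).rank = H.rank := by
    rw [Matrix.rank_transpose_mul_self]
    refine le_antisymm (by simpa using F.rank_le_width) ?_
    conv_lhs => rw [hH]
    exact Matrix.rank_mul_le_left F C
  have hu : IsUnit (Fᵀ * F).det := by
    rw [← Matrix.isUnit_iff_isUnit_det]
    rw [← Matrix.linearIndependent_rows_iff_isUnit, linearIndependent_iff_card_eq_finrank_span,
      Fintype.card_fin, Set.finrank, ← Matrix.rank_eq_finrank_span_row, hrank]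
  refine ⟨F, C, (Fᵀ * F)⁻¹ * Fᵀ, hH, hC, ?_, ?_⟩
  · rw [Matrix.mul_assoc, Matrix.nonsing_inv_mul _ hu]
  · simp only [Matrix.transpose_mul, Matrix.transpose_transpose, Matrix.transpose_nonsing_inv,
      Matrix.mul_assoc]

/-! ### Rows and columns of Gaussian matrices -/

theorem measurePreserving_curry {α : Type*} (ι κ : Type*) [MeasurableSpace α] [Fintype ι]
    [Fintype κ] (μ : Measure α) [IsProbabilityMeasure μ] :
    MeasurePreserving (MeasurableEquiv.curry ι κ α) (Measure.pi fun _ : ι × κ => μ)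
      (Measure.pi fun _ : ι => Measure.pi fun _ : κ => μ) :=
  ⟨(MeasurableEquiv.curry ι κ α).measurable, by
    simpa only [Measure.infinitePi_eq_pi] using
      Measure.infinitePi_map_curry (fun (_ : ι) (_ : κ) => μ)⟩

theorem measurePreserving_pi_pi_swap {α ι κ : Type*} [MeasurableSpace α] [Fintype ι] [Fintype κ]
    (μ : Measure α) [IsProbabilityMeasure μ] :
    MeasurePreserving (fun (x : ι → κ → α) k i => x i k)
      (Measure.pi fun _ : ι => Measure.pi fun _ : κ => μ)
      (Measure.pi fun _ : κ => Measure.pi fun _ : ι => μ) := by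
  have hswap := measurePreserving_arrowCongr' (fun _ : ι × κ => μ) (fun _ : κ × ι => μ)
    (Equiv.prodComm ι κ) (MeasurableEquiv.refl α) fun _ => MeasurePreserving.id μ
  exact ((measurePreserving_curry κ ι μ).comp hswap).comp (measurePreserving_curry ι κ μ).symm

theorem measurePreserving_pi_toLp_stdGaussian (ι κ : Type*) [Fintype ι] [Fintype κ] :
    MeasurePreserving (fun (x : ι → κ → ℝ) i => (WithLp.toLp 2 (x i) : EuclideanSpace ℝ κ))
      (Measure.pi fun _ : ι => Measure.pi fun _ : κ => gaussianReal 0 1)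
      (Measure.pi fun _ : ι => stdGaussian (EuclideanSpace ℝ κ)) :=
  measurePreserving_pi _ _ fun _ => ⟨by fun_prop, map_pi_eq_stdGaussian⟩

/-- The columns of a matrix with i.i.d. standard Gaussian rows are i.i.d. standard Gaussian. -/
theorem measurePreserving_transpose_stdGaussian (ι κ : Type*) [Fintype ι] [Fintype κ] :
    MeasurePreserving
      (fun (y : ι → EuclideanSpace ℝ κ) (k : κ) =>
        (WithLp.toLp 2 fun i => y i k : EuclideanSpace ℝ ι))
      (Measure.pi fun _ : ι => stdGaussian (EuclideanSpace ℝ κ))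
      (Measure.pi fun _ : κ => stdGaussian (EuclideanSpace ℝ ι)) := by
  refine ⟨by fun_prop, ?_⟩
  -- Both laws are images of one array of i.i.d. real Gaussians, read by rows or by columns.
  have h := ((measurePreserving_pi_toLp_stdGaussian κ ι).comp
    (measurePreserving_pi_pi_swap (ι := ι) (κ := κ)
    (gaussianReal 0 1))).map_eq
  rw [← (measurePreserving_pi_toLp_stdGaussian ι κ).map_eq,
    Measure.map_map (by fun_prop) (by fun_prop)]
  exact h

theorem stdGaussian_map_toEuclideanLin {r n : ℕ} {C : Matrix (Fin r) (Fin n) ℝ}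
    (hC : C * Cᵀ = 1) :
    (stdGaussian (EuclideanSpace ℝ (Fin n))).map (fun x => Matrix.toEuclideanLin C x)
      = stdGaussian (EuclideanSpace ℝ (Fin r)) := by
  refine stdGaussian_map_of_norm_adjoint (Matrix.toEuclideanLin C).toContinuousLinearMap fun y => ?_
  have hadj : ContinuousLinearMap.adjoint (Matrix.toEuclideanLin C).toContinuousLinearMap y
      = LinearMap.adjoint (Matrix.toEuclideanLin C) y := rfl
  rw [← sq_eq_sq₀ (norm_nonneg _) (norm_nonneg _), ← real_inner_self_eq_norm_sq,
    ← real_inner_self_eq_norm_sq, ContinuousLinearMap.adjoint_inner_left,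
    hadj, ← Matrix.toEuclideanLin_conjTranspose_eq_adjoint]
  congr 1
  simp [Matrix.toLpLin_apply, Matrix.conjTranspose_eq_transpose_of_trivial, hC]

/-- The rows of `C * X` are i.i.d. standard Gaussian when the columns of `X` are and `C` has
orthonormal rows. -/
theorem ColumnsIIDStdGaussian.hasLaw_rows_mul {Ω : Type*} [MeasurableSpace Ω] {P : Measure Ω}
    [IsProbabilityMeasure P] {r n T : ℕ} {X : Ω → Matrix (Fin n) (Fin T) ℝ}
    (hX : ColumnsIIDStdGaussian X P) {C : Matrix (Fin r) (Fin n) ℝ} (hC : C * Cᵀ = 1) :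
    HasLaw (fun ω (k : Fin r) => (WithLp.toLp 2 ((C * X ω) k) : EuclideanSpace ℝ (Fin T)))
      (Measure.pi fun _ : Fin r => stdGaussian (EuclideanSpace ℝ (Fin T))) P := by
  have hmeas : Measurable fun x : EuclideanSpace ℝ (Fin n) => Matrix.toEuclideanLin C x :=
    (LinearMap.continuous_of_finiteDimensional _).measurable
  have hlaw : ∀ t : Fin T, HasLaw (fun ω => Matrix.toEuclideanLin C
      (WithLp.toLp 2 fun i => X ω i t : EuclideanSpace ℝ (Fin n)))
      (stdGaussian (EuclideanSpace ℝ (Fin r))) P := fun t => by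
    have h := hX.law t
    rw [multivariateGaussian_zero_one] at h
    exact HasLaw.fun_comp ⟨hmeas.aemeasurable, stdGaussian_map_toEuclideanLin hC⟩ h
  have hindep := hX.indep.comp (fun _ x => Matrix.toEuclideanLin C x) fun _ => hmeas
  have hpi := iIndepFun.hasLaw_pi hlaw hindep
  have h := (measurePreserving_transpose_stdGaussian (Fin T) (Fin r)).fun_comp_hasLaw hpi
  convert h using 4 with ω k
  ext t
  rfl

/-- The matrix `(W * Wᵀ)⁻¹ * W`, whose rows form the basis dual to the rows of `W`. -/
noncomputable def dualRows {r T : ℕ} (W : Matrix (Fin r) (Fin T) ℝ) : Matrix (Fin r) (Fin T) ℝ :=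
  (W * Wᵀ)⁻¹ * W

theorem mul_transpose_eq_gram {r T : ℕ} (W : Matrix (Fin r) (Fin T) ℝ) :
    W * Wᵀ = gram ℝ fun k => (WithLp.toLp 2 (W k) : EuclideanSpace ℝ (Fin T)) := by
  ext k l
  simp [Matrix.mul_apply, gram_apply, PiLp.inner_apply, mul_comm]

/-- This also holds for singular `W * Wᵀ`, whose inverse is then zero by convention, so no null set
has to be excluded. -/
theorem dualRows_mul_transpose {r T : ℕ} (W : Matrix (Fin r) (Fin T) ℝ) :
    dualRows W * (dualRows W)ᵀ = (W * Wᵀ)⁻¹ := by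
  have h : dualRows W * (dualRows W)ᵀ = (W * Wᵀ)⁻¹ * (W * Wᵀ) * (W * Wᵀ)⁻¹ := by
    simp only [dualRows, Matrix.transpose_mul, Matrix.transpose_nonsing_inv,
      Matrix.transpose_transpose, Matrix.mul_assoc]
  rw [h]
  by_cases hW : IsUnit (W * Wᵀ).det
  · rw [Matrix.nonsing_inv_mul _ hW, Matrix.one_mul]
  · rw [Matrix.nonsing_inv_apply_not_isUnit _ hW, Matrix.mul_zero]

theorem measurable_dualRows_apply {α : Type*} [MeasurableSpace α] {r T : ℕ}
    {W : α → Matrix (Fin r) (Fin T) ℝ} (hW : ∀ k t, Measurable fun a => W a k t) (k : Fin r)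
    (t : Fin T) : Measurable fun a => dualRows (W a) k t := by
  simp only [dualRows, Matrix.mul_apply]
  refine Finset.measurable_sum _ fun l _ => Measurable.mul ?_ (hW l t)
  refine measurable_matrix_inv_apply (fun i j => ?_) k l
  simp only [Matrix.mul_apply, Matrix.transpose_apply]
  exact Finset.measurable_sum _ fun s _ => (hW i s).mul (hW j s)

/-! ### Moments of the dual rows -/

section DualRows

variable {Ω : Type*} [MeasurableSpace Ω] {P : Measure Ω} {r T : ℕ}
  {W : Ω → Matrix (Fin r) (Fin T) ℝ}

theorem ae_isUnit_det_mul_transpose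
    (hW : HasLaw (fun ω (k : Fin r) => (WithLp.toLp 2 (W ω k) : EuclideanSpace ℝ (Fin T)))
      (Measure.pi fun _ : Fin r => stdGaussian (EuclideanSpace ℝ (Fin T))) P) (hr : r + 1 < T) :
    ∀ᵐ ω ∂P, IsUnit (W ω * (W ω)ᵀ).det := by
  have h := ae_linearIndependent_stdGaussian (E := EuclideanSpace ℝ (Fin T)) (r := r) (by simpa)
  rw [← hW.map_eq] at h
  filter_upwards [ae_of_ae_map hW.aemeasurable h] with ω hω
  rw [mul_transpose_eq_gram, isUnit_iff_ne_zero]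
  exact det_gram_ne_zero_iff_linearIndependent.2 hω

theorem integral_inv_mul_transpose_apply
    (hW : HasLaw (fun ω (k : Fin r) => (WithLp.toLp 2 (W ω k) : EuclideanSpace ℝ (Fin T)))
      (Measure.pi fun _ : Fin r => stdGaussian (EuclideanSpace ℝ (Fin T))) P) (hr : r + 1 < T)
    (k l : Fin r) :
    ∫ ω, (W ω * (W ω)ᵀ)⁻¹ k l ∂P = ((T : ℝ) - r - 1)⁻¹ * (1 : Matrix (Fin r) (Fin r) ℝ) k l := by
  simp_rw [mul_transpose_eq_gram]
  have h := hW.integral_comp (f := fun w => (gram ℝ w)⁻¹ k l)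
    (measurable_inv_gram_apply k l).aestronglyMeasurable
  refine h.trans ?_
  by_cases hkl : k = l
  · subst hkl
    rw [integral_inv_gram_apply_self (by simpa)]
    simp
  · rw [integral_inv_gram_apply_of_ne hkl, Matrix.one_apply_ne hkl, mul_zero]

theorem memLp_dualRows_apply
    (hW : HasLaw (fun ω (k : Fin r) => (WithLp.toLp 2 (W ω k) : EuclideanSpace ℝ (Fin T)))
      (Measure.pi fun _ : Fin r => stdGaussian (EuclideanSpace ℝ (Fin T))) P) (hr : r + 1 < T)
    (k : Fin r) (t : Fin T) : MemLp (fun ω => dualRows (W ω) k t) 2 P := by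
  have hmeas : Measurable fun w : Fin r → EuclideanSpace ℝ (Fin T) =>
      dualRows (Matrix.of fun k t => w k t) k t :=
    measurable_dualRows_apply (fun k t => by simp only [Matrix.of_apply]; fun_prop) k t
  have haem : AEStronglyMeasurable (fun ω => dualRows (W ω) k t) P :=
    (hmeas.comp_aemeasurable hW.aemeasurable).aestronglyMeasurable
  rw [memLp_two_iff_integrable_sq haem]
  have hint : Integrable (fun ω => (W ω * (W ω)ᵀ)⁻¹ k k) P := by
    have h := integrable_inv_gram_apply_self (E := EuclideanSpace ℝ (Fin T)) (by simpa using hr) k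
    rw [← hW.map_eq] at h
    simp_rw [mul_transpose_eq_gram]
    exact h.comp_aemeasurable hW.aemeasurable
  -- A squared entry is one term of the sum of squares giving the integrable diagonal entry of `(W *
  -- Wᵀ)⁻¹`.
  refine hint.mono' (haem.pow 2) (ae_of_all _ fun ω => ?_)
  rw [← dualRows_mul_transpose, Matrix.mul_apply, Real.norm_of_nonneg (sq_nonneg _), sq]
  exact Finset.single_le_sum (f := fun t => dualRows (W ω) k t * (dualRows (W ω))ᵀ t k)
    (fun t _ => mul_self_nonneg _) (Finset.mem_univ t)

theorem sum_integral_dualRows_mul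
    (hW : HasLaw (fun ω (k : Fin r) => (WithLp.toLp 2 (W ω k) : EuclideanSpace ℝ (Fin T)))
      (Measure.pi fun _ : Fin r => stdGaussian (EuclideanSpace ℝ (Fin T))) P) (hr : r + 1 < T)
    {m : ℕ} (L : Matrix (Fin r) (Fin m) ℝ) (i j : Fin m) :
    ∑ t, ∫ ω, (Lᵀ * dualRows (W ω)) i t * (Lᵀ * dualRows (W ω)) j t ∂P
      = ((T : ℝ) - r - 1)⁻¹ * (Lᵀ * L) i j := by
  have hint : ∀ k l t, Integrable (fun ω => dualRows (W ω) k t * dualRows (W ω) l t) P :=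
    fun k l t => (memLp_dualRows_apply hW hr k t).integrable_mul (memLp_dualRows_apply hW hr l t)
  have hexp : ∀ t, ∫ ω, (Lᵀ * dualRows (W ω)) i t * (Lᵀ * dualRows (W ω)) j t ∂P
      = ∑ k, ∑ l, L k i * L l j * ∫ ω, dualRows (W ω) k t * dualRows (W ω) l t ∂P := by
    intro t
    have h : ∀ ω, (Lᵀ * dualRows (W ω)) i t * (Lᵀ * dualRows (W ω)) j t
        = ∑ k, ∑ l, L k i * L l j * (dualRows (W ω) k t * dualRows (W ω) l t) := by
      intro ω
      simp only [Matrix.mul_apply, Matrix.transpose_apply, Finset.sum_mul_sum]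
      exact Finset.sum_congr rfl fun k _ => Finset.sum_congr rfl fun l _ => by ring
    simp_rw [h]
    rw [integral_finsetSum _ fun k _ => integrable_finsetSum _ fun l _ => (hint k l t).const_mul _]
    refine Finset.sum_congr rfl fun k _ => ?_
    rw [integral_finsetSum _ fun l _ => (hint k l t).const_mul _]
    simp_rw [integral_const_mul]
  have hsum : ∀ k l, ∑ t, ∫ ω, dualRows (W ω) k t * dualRows (W ω) l t ∂P
      = ((T : ℝ) - r - 1)⁻¹ * (1 : Matrix (Fin r) (Fin r) ℝ) k l := by
    intro k l
    rw [← integral_inv_mul_transpose_apply hW hr, ← integral_finsetSum _ fun t _ => hint k l t]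
    simp_rw [← dualRows_mul_transpose, Matrix.mul_apply, Matrix.transpose_apply]
  simp_rw [hexp]
  rw [Finset.sum_comm]
  simp_rw [Finset.sum_comm (s := (Finset.univ : Finset (Fin T))), ← Finset.mul_sum, hsum,
    Matrix.one_apply]
  simp only [mul_ite, mul_one, mul_zero, Finset.sum_ite_eq, Finset.mem_univ, if_true,
    Matrix.mul_apply, Matrix.transpose_apply, Finset.mul_sum]
  exact Finset.sum_congr rfl fun k _ => by ring

end DualRows

/-! ### Random matrices applied to independent noise -/

section IndependentNoise

variable {Ω : Type*} [MeasurableSpace Ω] {P : Measure Ω} {m T : ℕ}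

theorem EntriesIIDGaussian.memLp_apply {E : Ω → Matrix (Fin m) (Fin T) ℝ} {σ : ℝ≥0}
    (hE : EntriesIIDGaussian E σ P) (i : Fin m) (t : Fin T) : MemLp (fun ω => E ω i t) 2 P := by
  have h := memLp_id_gaussianReal (μ := 0) (v := σ ^ 2) 2
  rw [← (hE.law i t).map_eq] at h
  exact h.comp_of_map (hE.law i t).aemeasurable

theorem EntriesIIDGaussian.integral_apply {E : Ω → Matrix (Fin m) (Fin T) ℝ} {σ : ℝ≥0}
    (hE : EntriesIIDGaussian E σ P) (i : Fin m) (t : Fin T) : ∫ ω, E ω i t ∂P = 0 := by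
  rw [(hE.law i t).integral_eq, integral_id_gaussianReal]

theorem EntriesIIDGaussian.integral_mul_apply {E : Ω → Matrix (Fin m) (Fin T) ℝ} {σ : ℝ≥0}
    (hE : EntriesIIDGaussian E σ P) (i j : Fin m) (t s : Fin T) :
    ∫ ω, E ω i t * E ω j s ∂P = if i = j ∧ t = s then (σ : ℝ) ^ 2 else 0 := by
  split_ifs with h
  · obtain ⟨rfl, rfl⟩ := h
    have hv := (hE.law i t).variance_eq
    rw [variance_of_integral_eq_zero (hE.law i t).aemeasurable (hE.integral_apply i t),
      variance_id_gaussianReal] at hv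
    simpa [sq] using hv
  · have hind : IndepFun (fun ω => E ω i t) (fun ω => E ω j s) P :=
      hE.indep.indepFun (i := (i, t)) (j := (j, s)) (by simpa using h)
    rw [hind.integral_fun_mul_eq_mul_integral (hE.memLp_apply i t).1 (hE.memLp_apply j s).1,
      hE.integral_apply, zero_mul]

theorem EntriesIIDGaussian.memLp_transpose_mulVec {E : Ω → Matrix (Fin m) (Fin T) ℝ} {σ : ℝ≥0}
    (hE : EntriesIIDGaussian E σ P) (u : Fin m → ℝ) (t : Fin T) :
    MemLp (fun ω => ((E ω)ᵀ *ᵥ u) t) 2 P := by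
  simp only [Matrix.mulVec, dotProduct, Matrix.transpose_apply]
  exact memLp_finsetSum _ fun i _ => (hE.memLp_apply i t).mul_const _

theorem EntriesIIDGaussian.integral_transpose_mulVec [IsProbabilityMeasure P]
    {E : Ω → Matrix (Fin m) (Fin T) ℝ} {σ : ℝ≥0} (hE : EntriesIIDGaussian E σ P)
    (u : Fin m → ℝ) (t : Fin T) :
    ∫ ω, ((E ω)ᵀ *ᵥ u) t ∂P = 0 := by
  simp only [Matrix.mulVec, dotProduct, Matrix.transpose_apply]
  rw [integral_finsetSum _ fun i _ =>
    ((hE.memLp_apply i t).integrable one_le_two).mul_const _]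
  simp [integral_mul_const, hE.integral_apply]

theorem EntriesIIDGaussian.integral_transpose_mulVec_mul {E : Ω → Matrix (Fin m) (Fin T) ℝ}
    {σ : ℝ≥0} (hE : EntriesIIDGaussian E σ P) {u : Fin m → ℝ} (hu : u ⬝ᵥ u = 1) (t s : Fin T) :
    ∫ ω, ((E ω)ᵀ *ᵥ u) t * ((E ω)ᵀ *ᵥ u) s ∂P = if t = s then (σ : ℝ) ^ 2 else 0 := by
  have hexp : ∀ ω, ((E ω)ᵀ *ᵥ u) t * ((E ω)ᵀ *ᵥ u) s
      = ∑ i, ∑ j, u i * u j * (E ω i t * E ω j s) := by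
    intro ω
    simp only [Matrix.mulVec, dotProduct, Matrix.transpose_apply, Finset.sum_mul_sum]
    exact Finset.sum_congr rfl fun k _ => Finset.sum_congr rfl fun l _ => by ring
  have hint : ∀ i j, Integrable (fun ω => E ω i t * E ω j s) P :=
    fun i j => (hE.memLp_apply i t).integrable_mul (hE.memLp_apply j s)
  simp_rw [hexp]
  rw [integral_finsetSum _ fun k _ => integrable_finsetSum _ fun l _ => (hint k l).const_mul _]
  simp_rw [fun k => integral_finsetSum (μ := P) Finset.univ
    fun l _ => (hint k l).const_mul (u k * u l), integral_const_mul, hE.integral_mul_apply]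
  by_cases hts : t = s
  · simp only [hts, and_true, if_true, mul_ite, mul_zero, Finset.sum_ite_eq, Finset.mem_univ,
      ← Finset.sum_mul]
    rw [← dotProduct, hu, one_mul]
  · simp [hts]

variable {A : Ω → Matrix (Fin m) (Fin T) ℝ} {g : Ω → Fin T → ℝ}

/-- Square-integrable factors alone give only integrable products; by independence the product of
the squares is integrable too. -/
theorem memLp_mulVec_of_indepFun (hAg : IndepFun (fun ω i t => A ω i t) g P)
    (hA : ∀ i t, MemLp (fun ω => A ω i t) 2 P) (hg : ∀ t, MemLp (fun ω => g ω t) 2 P)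
    (i : Fin m) : MemLp (fun ω => (A ω *ᵥ g ω) i) 2 P := by
  simp only [Matrix.mulVec, dotProduct]
  refine memLp_finsetSum _ fun t _ => ?_
  refine (memLp_two_iff_integrable_sq ((hA i t).1.mul (hg t).1)).2 ?_
  have hind : IndepFun (fun ω => A ω i t ^ 2) (fun ω => g ω t ^ 2) P :=
    hAg.comp (φ := fun a : Fin m → Fin T → ℝ => a i t ^ 2)
      (ψ := fun x : Fin T → ℝ => x t ^ 2) (by fun_prop) (by fun_prop)
  simpa only [mul_pow, Pi.mul_def] using
    hind.integrable_mul (hA i t).integrable_sq (hg t).integrable_sq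

theorem integral_mulVec_of_indepFun (hAg : IndepFun (fun ω i t => A ω i t) g P)
    (hA : ∀ i t, MemLp (fun ω => A ω i t) 2 P) (hg : ∀ t, MemLp (fun ω => g ω t) 2 P)
    (hg0 : ∀ t, ∫ ω, g ω t ∂P = 0) (i : Fin m) : ∫ ω, (A ω *ᵥ g ω) i ∂P = 0 := by
  simp only [Matrix.mulVec, dotProduct]
  have hint : ∀ t, Integrable (fun ω => A ω i t * g ω t) P :=
    fun t => (hA i t).integrable_mul (hg t)
  rw [integral_finsetSum _ fun t _ => hint t]
  refine Finset.sum_eq_zero fun t _ => ?_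
  have hind : IndepFun (fun ω => A ω i t) (fun ω => g ω t) P :=
    hAg.comp (φ := fun a : Fin m → Fin T → ℝ => a i t) (ψ := fun x : Fin T → ℝ => x t)
      (by fun_prop) (by fun_prop)
  rw [hind.integral_fun_mul_eq_mul_integral (hA i t).1 (hg t).1, hg0, mul_zero]

theorem integral_mulVec_mul_of_indepFun (hAg : IndepFun (fun ω i t => A ω i t) g P)
    (hA : ∀ i t, MemLp (fun ω => A ω i t) 2 P) (hg : ∀ t, MemLp (fun ω => g ω t) 2 P) {v : ℝ}
    (hgg : ∀ t s, ∫ ω, g ω t * g ω s ∂P = if t = s then v else 0) (i j : Fin m) :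
    ∫ ω, (A ω *ᵥ g ω) i * (A ω *ᵥ g ω) j ∂P = v * ∑ t, ∫ ω, A ω i t * A ω j t ∂P := by
  have hexp : ∀ ω, (A ω *ᵥ g ω) i * (A ω *ᵥ g ω) j
      = ∑ t, ∑ s, (A ω i t * A ω j s) * (g ω t * g ω s) := by
    intro ω
    simp only [Matrix.mulVec, dotProduct, Finset.sum_mul_sum]
    exact Finset.sum_congr rfl fun k _ => Finset.sum_congr rfl fun l _ => by ring
  have hind : ∀ t s, IndepFun (fun ω => A ω i t * A ω j s) (fun ω => g ω t * g ω s) P :=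
    fun t s => hAg.comp (φ := fun a : Fin m → Fin T → ℝ => a i t * a j s)
      (ψ := fun x : Fin T → ℝ => x t * x s)
      (by fun_prop) (by fun_prop)
  have hA2 : ∀ t s, Integrable (fun ω => A ω i t * A ω j s) P :=
    fun t s => (hA i t).integrable_mul (hA j s)
  have hg2 : ∀ t s, Integrable (fun ω => g ω t * g ω s) P :=
    fun t s => (hg t).integrable_mul (hg s)
  have hint : ∀ t s, Integrable (fun ω => (A ω i t * A ω j s) * (g ω t * g ω s)) P :=
    fun t s => (hind t s).integrable_mul (hA2 t s) (hg2 t s)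
  simp_rw [hexp]
  rw [integral_finsetSum _ fun t _ => integrable_finsetSum _ fun s _ => hint t s, Finset.mul_sum]
  refine Finset.sum_congr rfl fun t _ => ?_
  rw [integral_finsetSum _ fun s _ => hint t s]
  simp_rw [fun s => (hind t s).integral_fun_mul_eq_mul_integral (hA2 t s).1 (hg2 t s).1, hgg]
  simp [mul_comm]

end IndependentNoise

/-! ### Covariance of the first-order error -/

theorem mainTheorem3 {Ω : Type*} [MeasurableSpace Ω] (P : Measure Ω) [IsProbabilityMeasure P]
    {m n T : ℕ} (H : Matrix (Fin m) (Fin n) ℝ) (hrank : H.rank + 1 = n) (hT : n < T)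
    (σ : ℝ≥0) (nv : Fin m → ℝ) (hnv : nv ⬝ᵥ nv = 1)
    (X : Ω → Matrix (Fin n) (Fin T) ℝ) (E : Ω → Matrix (Fin m) (Fin T) ℝ)
    (hX : ColumnsIIDStdGaussian X P) (hE : EntriesIIDGaussian E σ P)
    (hZE : IndepFun (fun ω i t => (H * X ω) i t) (fun ω i t => E ω i t) P) :
    (∀ i, MemLp (fun ω => firstOrderError (H * X ω) (E ω) nv i) 2 P) ∧
    meanVec (fun ω => firstOrderError (H * X ω) (E ω) nv) P = 0 ∧
    covMatrix (fun ω => firstOrderError (H * X ω) (E ω) nv) P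
      = ((σ : ℝ) ^ 2 / ((T : ℝ) - (n : ℝ))) • pinv (H * Hᵀ) := by
  obtain ⟨r, hr', F, C, L, hH, hC, hLF, hFL⟩ : ∃ r, H.rank = r ∧
      ∃ (F : Matrix (Fin m) (Fin r) ℝ) (C : Matrix (Fin r) (Fin n) ℝ)
        (L : Matrix (Fin r) (Fin m) ℝ), H = F * C ∧ C * Cᵀ = 1 ∧ L * F = 1 ∧ (F * L)ᵀ = F * L :=
    ⟨_, rfl, exists_rank_factorization H⟩
  have hr : r + 1 < T := by omega
  have hW := hX.hasLaw_rows_mul hC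
  -- Independence is assumed for `H * X` and not for `X`; recovering `C * X` from `H * X` makes `A`
  -- a measurable function of `H * X`.
  have hLZ : ∀ ω, C * X ω = L * (H * X ω) := fun ω => by
    rw [hH, Matrix.mul_assoc F, ← Matrix.mul_assoc L, hLF, Matrix.one_mul]
  set A : Ω → Matrix (Fin m) (Fin T) ℝ := fun ω => Lᵀ * dualRows (C * X ω) with hAdef
  set g : Ω → Fin T → ℝ := fun ω => (E ω)ᵀ *ᵥ nv
  have hA : ∀ i t, MemLp (fun ω => A ω i t) 2 P := fun i t => by
    simp only [hAdef, Matrix.mul_apply, Matrix.transpose_apply]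
    exact memLp_finsetSum _ fun k _ => (memLp_dualRows_apply hW hr k t).const_mul _
  have hg : ∀ t, MemLp (fun ω => g ω t) 2 P := hE.memLp_transpose_mulVec nv
  have hAg : IndepFun (fun ω i t => A ω i t) g P := by
    have hφ : Measurable fun (Z : Fin m → Fin T → ℝ) (i : Fin m) (t : Fin T) =>
        (Lᵀ * dualRows (L * Matrix.of Z)) i t := by
      refine measurable_pi_lambda _ fun i => measurable_pi_lambda _ fun t => ?_
      simp only [Matrix.mul_apply (M := Lᵀ)]
      refine Finset.measurable_sum _ fun k _ => Measurable.const_mul ?_ _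
      refine measurable_dualRows_apply (fun k t => ?_) k t
      simp only [Matrix.mul_apply, Matrix.of_apply]
      fun_prop
    have hψ : Measurable fun (e : Fin m → Fin T → ℝ) => (Matrix.of e)ᵀ *ᵥ nv := by
      refine measurable_pi_lambda _ fun t => ?_
      simp only [Matrix.mulVec, dotProduct, Matrix.transpose_apply, Matrix.of_apply]
      fun_prop
    simp only [hAdef, hLZ]
    exact hZE.comp hφ hψ
  -- Replacing `pinv` almost surely by the explicit measurable `A` makes measurability of `pinv`
  -- unnecessary.
  have hδ : ∀ᵐ ω ∂P, ∀ i, firstOrderError (H * X ω) (E ω) nv i = -(A ω *ᵥ g ω) i := by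
    filter_upwards [ae_isUnit_det_mul_transpose hW hr] with ω hω i
    have hpinv : pinv (H * X ω)ᵀ = A ω := by
      refine (pinv_spec _).unique ?_
      have h := isMoorePenrose_transpose_mul hLF hFL hω
      rwa [← Matrix.mul_assoc, ← hH] at h
    rw [firstOrderError, hpinv, ← Matrix.mulVec_mulVec, Pi.neg_apply]
  have hδi : ∀ i, (fun ω => firstOrderError (H * X ω) (E ω) nv i)
      =ᵐ[P] fun ω => -(A ω *ᵥ g ω) i := fun i => by
    filter_upwards [hδ] with ω hω using hω i
  have hmem : ∀ i, MemLp (fun ω => firstOrderError (H * X ω) (E ω) nv i) 2 P := fun i =>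
    (memLp_congr_ae (hδi i)).2 (memLp_mulVec_of_indepFun hAg hA hg i).neg
  have hmean : ∀ i, ∫ ω, firstOrderError (H * X ω) (E ω) nv i ∂P = 0 := fun i => by
    rw [integral_congr_ae (hδi i), integral_neg, integral_mulVec_of_indepFun hAg hA hg
      (hE.integral_transpose_mulVec nv), neg_zero]
  refine ⟨hmem, funext hmean, ?_⟩
  ext i j
  have hpinvH : pinv (H * Hᵀ) = Lᵀ * L := by
    refine (pinv_spec _).unique ?_
    have h := isMoorePenrose_mul_transpose hLF hFL hC
    rwa [← hH] at h
  have hprod : ∫ ω, firstOrderError (H * X ω) (E ω) nv i * firstOrderError (H * X ω) (E ω) nv j ∂P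
      = ∫ ω, (A ω *ᵥ g ω) i * (A ω *ᵥ g ω) j ∂P := by
    refine integral_congr_ae ?_
    filter_upwards [hδ] with ω hω
    rw [hω, hω, neg_mul_neg]
  have hn : (n : ℝ) = r + 1 := by rw [← hrank, hr']; push_cast; rfl
  rw [covMatrix, Matrix.of_apply, covariance_eq_sub (hmem i) (hmem j), hmean i, zero_mul, sub_zero]
  refine hprod.trans ?_
  rw [integral_mulVec_mul_of_indepFun hAg hA hg (hE.integral_transpose_mulVec_mul hnv),
    sum_integral_dualRows_mul hW hr, hpinvH, Matrix.smul_apply, smul_eq_mul, hn, div_eq_mul_inv,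
    ← mul_assoc, sub_add_eq_sub_sub]
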